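/- Let $E$ be a real Banach lattice. A sequence $(x_n)$ in $E$ is disjoint if $|x_m|\wedge|x_n|=0$ for $m\neq n$. A set $A\subseteq E$ is an \emph{Lwc set} if every disjoint sequence in its solid hull $\bigcup_{a\in A}[-|a|,|a|]$ converges to $0$ in norm. A bounded set $A\subseteq E$ is \emph{limited} if every weak$^*$-null sequence in the norm dual $E'$ converges to $0$ uniformly on $A$. A bounded linear operator $T:E\to E$ is \emph{l-Lwc} if it maps limited sets onto Lwc sets, and \emph{l-Mwc} if $Tx_n\to 0$ weakly for every disjoint bounded sequence $(x_n)$ in $E$. Let $\mathrm{L}_r(E)$ be the algebra of regular operators on $E$ (differences of two positive bounded operators), ordered by $S\le T$ iff $Sx\le Tx$ for all $x\geq 0$, with the regular norm $\|T\|_r=\inf\{\|S\|: S \text{ a bounded operator on } E,\ \pm T\le S\}$. Let $\text{r-l-Lwc}(E)$ (resp. $\text{r-l-Mwc}(E)$) be the set of all operators $T_1-T_2$ with $T_1,T_2$ positive l-Lwc (resp. positive l-Mwc) operators on $E$, and let $I_E$ be the identity operator. Then: (i) $\text{r-l-Lwc}(E)$ and $\text{r-l-Mwc}(E)$ are (not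 necessarily unital) subalgebras of $\mathrm{L}_r(E)$. Moreover, $$\text{r-l-Lwc}(E)=\mathrm{L}_r(E)\iff I_E \text{ is l-Lwc},\qquad \text{r-l-Mwc}(E)=\mathrm{L}_r(E)\iff I_E\text{ is l-Mwc}.$$ (ii) If $E$ is Dedekind complete (every non-empty subset that is bounded above has a supremum), then $(\mathrm{L}_r(E),\|\cdot\|_r)$ is a Banach lattice, and $\text{r-l-Lwc}(E)$ and $\text{r-l-Mwc}(E)$ are closed order ideals in it (norm-closed vector subspaces $I$ such that $|S|\le|T|$ and $T\in I$ imply $S\in I$). -/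

import Mathlib

open Filter Topology

/-! ### Disjointness, Dedekind completeness, L-weakly compact sets and limited sets -/

/-- A sequence in a vector lattice is disjoint if `|x m| ∧ |x n| = 0` for `m ≠ n`. -/
def IsDisjointSeq {F : Type*} [Lattice F] [AddCommGroup F] (x : ℕ → F) : Prop :=
  ∀ m n, m ≠ n → |x m| ⊓ |x n| = 0

/-- Every non-empty subset that is bounded above has a supremum. -/
def IsDedekindComplete (E : Type*) [Lattice E] : Prop :=
  ∀ s : Set E, s.Nonempty → BddAbove s → ∃ a, IsLUB s a

/-- An Lwc set: each disjoint sequence in its solid hull is norm-null. -/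
def IsLwcSet {F : Type*} [NormedAddCommGroup F] [Lattice F] (A : Set F) : Prop :=
  ∀ x : ℕ → F, (∀ n, x n ∈ LatticeOrderedAddCommGroup.solidClosure A) → IsDisjointSeq x →
    Tendsto x atTop (𝓝 0)

/-- A limited set: a bounded set on which every weak-star null sequence of the dual is
uniformly null. -/
def IsLimitedSet {X : Type*} [NormedAddCommGroup X] [NormedSpace ℝ X] (A : Set X) : Prop :=
  Bornology.IsBounded A ∧
    ∀ f : ℕ → WeakDual ℝ X, Tendsto f atTop (𝓝 0) →
      TendstoUniformlyOn (fun n x => f n x) (fun _ => (0 : ℝ)) atTop A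

/-! ### Classes of operators -/

/-- `T` is an l-Lwc (limitedly L-weakly compact) operator. -/
def IsLLwc {X F : Type*} [NormedAddCommGroup X] [NormedSpace ℝ X]
    [NormedAddCommGroup F] [NormedSpace ℝ F] [Lattice F] (T : X →L[ℝ] F) : Prop :=
  ∀ A : Set X, IsLimitedSet A → IsLwcSet (T '' A)

/-- `T` is an l-Mwc (limitedly M-weakly compact) operator: `T x n → 0` weakly for every disjoint
bounded sequence `x`. -/
def IsLMwc {E Y : Type*} [NormedAddCommGroup E] [NormedSpace ℝ E] [Lattice E]
    [NormedAddCommGroup Y] [NormedSpace ℝ Y] (T : E →L[ℝ] Y) : Prop :=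
  ∀ x : ℕ → E, IsDisjointSeq x → Bornology.IsBounded (Set.range x) →
    Tendsto (fun n => toWeakSpace ℝ Y (T (x n))) atTop (𝓝 0)

/-- Positive operators. -/
def IsPositiveOp {E F : Type*} [NormedAddCommGroup E] [NormedSpace ℝ E] [Lattice E]
    [NormedAddCommGroup F] [NormedSpace ℝ F] [Lattice F] (T : E →L[ℝ] F) : Prop :=
  ∀ x, 0 ≤ x → 0 ≤ T x

/-- The r-`P`-operators: differences of two positive operators belonging to `P`. -/
def IsRegularIn {E F : Type*} [NormedAddCommGroup E] [NormedSpace ℝ E] [Lattice E]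
    [NormedAddCommGroup F] [NormedSpace ℝ F] [Lattice F] (P : Set (E →L[ℝ] F))
    (T : E →L[ℝ] F) : Prop :=
  ∃ T₁ ∈ P, ∃ T₂ ∈ P, IsPositiveOp T₁ ∧ IsPositiveOp T₂ ∧ T = T₁ - T₂

/-! ### The algebra of regular operators, its order, and the regular norm -/

section Regular

variable (E : Type*) [NormedAddCommGroup E] [NormedSpace ℝ E] [Lattice E]
  [IsOrderedAddMonoid E] [IsOrderedModule ℝ E]

/-- The regular operators on `E` form a unital subalgebra of the algebra of bounded operators. -/
def regularSubalgebra : Subalgebra ℝ (E →L[ℝ] E) where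
  carrier := {T | IsRegularIn Set.univ T}
  mul_mem' := by
    rintro _ _ ⟨A, -, B, -, hA, hB, rfl⟩ ⟨C, -, D, -, hC, hD, rfl⟩
    refine ⟨A * C + B * D, trivial, A * D + B * C, trivial, ?_, ?_, ?_⟩
    · exact fun x hx => add_nonneg (hA _ (hC x hx)) (hB _ (hD x hx))
    · exact fun x hx => add_nonneg (hA _ (hD x hx)) (hB _ (hC x hx))
    · noncomm_ring
  add_mem' := by
    rintro _ _ ⟨A, -, B, -, hA, hB, rfl⟩ ⟨C, -, D, -, hC, hD, rfl⟩
    refine ⟨A + C, trivial, B + D, trivial, ?_, ?_, ?_⟩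
    · exact fun x hx => add_nonneg (hA x hx) (hC x hx)
    · exact fun x hx => add_nonneg (hB x hx) (hD x hx)
    · abel
  algebraMap_mem' := by
    intro r
    refine ⟨max r 0 • 1, trivial, max (-r) 0 • 1, trivial, ?_, ?_, ?_⟩
    · exact fun x hx => smul_nonneg (le_max_right _ _) hx
    · exact fun x hx => smul_nonneg (le_max_right _ _) hx
    · rw [← sub_smul, Algebra.algebraMap_eq_smul_one]
      congr 1
      rcases le_total r 0 with h | h
      · rw [max_eq_right h, max_eq_left (by linarith)]; ring
      · rw [max_eq_left h, max_eq_right (by linarith)]; ring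

/-- The algebra `L_r(E)` of regular operators on `E`. It is a type of its own because it carries
the regular norm and not the operator norm. -/
def RegOp : Type _ := regularSubalgebra E

namespace RegOp

noncomputable instance instRing : Ring (RegOp E) :=
  inferInstanceAs (Ring (regularSubalgebra E))

noncomputable instance instAlgebra : Algebra ℝ (RegOp E) :=
  inferInstanceAs (Algebra ℝ (regularSubalgebra E))

variable {E}

/-- The bounded operator underlying a regular operator. -/
def toOp (T : RegOp E) : E →L[ℝ] E := Subtype.val T

theorem toOp_injective : Function.Injective (toOp (E := E)) := Subtype.val_injective

@[simp] theorem toOp_zero : toOp (0 : RegOp E) = 0 := rfl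
@[simp] theorem toOp_one : toOp (1 : RegOp E) = ContinuousLinearMap.id ℝ E := rfl
@[simp] theorem toOp_add (S T : RegOp E) : toOp (S + T) = toOp S + toOp T := rfl
@[simp] theorem toOp_neg (T : RegOp E) : toOp (-T) = -toOp T := rfl
@[simp] theorem toOp_sub (S T : RegOp E) : toOp (S - T) = toOp S - toOp T := rfl
@[simp] theorem toOp_mul (S T : RegOp E) : toOp (S * T) = (toOp S).comp (toOp T) := rfl
@[simp] theorem toOp_smul (c : ℝ) (T : RegOp E) : toOp (c • T) = c • toOp T := rfl

/-- The order of operators: `S ≤ T` iff `S x ≤ T x` for all `x ≥ 0`. -/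
instance instPartialOrder : PartialOrder (RegOp E) where
  le S T := ∀ x : E, 0 ≤ x → toOp S x ≤ toOp T x
  le_refl _ _ _ := le_rfl
  le_trans _ _ _ h h' x hx := (h x hx).trans (h' x hx)
  le_antisymm S T h h' := by
    refine toOp_injective (ContinuousLinearMap.ext fun x => ?_)
    rw [← posPart_sub_negPart x, map_sub, map_sub,
      (h _ (posPart_nonneg x)).antisymm (h' _ (posPart_nonneg x)),
      (h _ (negPart_nonneg x)).antisymm (h' _ (negPart_nonneg x))]

theorem le_def (S T : RegOp E) : S ≤ T ↔ ∀ x : E, 0 ≤ x → toOp S x ≤ toOp T x := Iff.rfl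

instance instIsOrderedAddMonoid : IsOrderedAddMonoid (RegOp E) where
  add_le_add_left S T h U x hx := by simpa using h x hx

instance instIsOrderedModule : IsOrderedModule ℝ (RegOp E) where
  smul_le_smul_of_nonneg_left _ hc _ _ h x hx := smul_le_smul_of_nonneg_left (h x hx) hc
  smul_le_smul_of_nonneg_right _ hT _ _ h x hx :=
    smul_le_smul_of_nonneg_right h (hT x hx)

/-- The bounded operators `S` with `± T ≤ S`. -/
def dominants (T : RegOp E) : Set (E →L[ℝ] E) :=
  {S | ∀ x : E, 0 ≤ x → toOp T x ≤ S x ∧ -(toOp T x) ≤ S x}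

/-- The regular norm `inf {‖S‖ : ± T ≤ S}`. -/
noncomputable instance instNorm : Norm (RegOp E) where
  norm T := sInf ((fun S : E →L[ℝ] E => ‖S‖) '' dominants T)

theorem norm_def (T : RegOp E) : ‖T‖ = sInf ((fun S : E →L[ℝ] E => ‖S‖) '' dominants T) := rfl

theorem dominants_nonempty (T : RegOp E) : (dominants T).Nonempty := by
  obtain ⟨_, A, -, B, -, hA, hB, rfl⟩ := T
  refine ⟨A + B, fun x hx => ?_⟩
  have h1 := hA x hx
  have h2 := hB x hx
  change A x - B x ≤ A x + B x ∧ -(A x - B x) ≤ A x + B x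
  constructor
  · exact (sub_le_self _ h2).trans (le_add_of_nonneg_right h2)
  · rw [neg_sub]
    exact (sub_le_self _ h1).trans (le_add_of_nonneg_left h1)

theorem norm_le_of_mem {T : RegOp E} {S : E →L[ℝ] E} (h : S ∈ dominants T) : ‖T‖ ≤ ‖S‖ :=
  csInf_le ⟨0, by rintro _ ⟨S, -, rfl⟩; exact norm_nonneg S⟩ ⟨S, h, rfl⟩

theorem le_norm_of_forall {T : RegOp E} {c : ℝ} (h : ∀ S ∈ dominants T, c ≤ ‖S‖) : c ≤ ‖T‖ :=
  le_csInf ((dominants_nonempty T).image _) (by rintro _ ⟨S, hS, rfl⟩; exact h S hS)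

theorem norm_toOp_le_of_mem [HasSolidNorm E] {T : RegOp E} {S : E →L[ℝ] E}
    (h : S ∈ dominants T) : ‖toOp T‖ ≤ ‖S‖ := by
  refine ContinuousLinearMap.opNorm_le_bound _ (norm_nonneg S) fun x => ?_
  have key : |toOp T x| ≤ S |x| := by
    have hp := h _ (posPart_nonneg x)
    have hn := h _ (negPart_nonneg x)
    have e1 : toOp T x = toOp T x⁺ - toOp T x⁻ := by
      rw [← map_sub, posPart_sub_negPart]
    have e2 : S |x| = S x⁺ + S x⁻ := by rw [← map_add, posPart_add_negPart]
    rw [abs_le', e1, e2]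
    constructor
    · rw [sub_eq_add_neg]; exact add_le_add hp.1 hn.2
    · rw [neg_sub, sub_eq_add_neg, add_comm]; exact add_le_add hp.2 hn.1
  calc ‖toOp T x‖ ≤ ‖S |x|‖ := norm_le_norm_of_abs_le_abs (key.trans (le_abs_self _))
    _ ≤ ‖S‖ * ‖|x|‖ := S.le_opNorm _
    _ = ‖S‖ * ‖x‖ := by rw [norm_abs_eq_norm]

theorem norm_toOp_le [HasSolidNorm E] (T : RegOp E) : ‖toOp T‖ ≤ ‖T‖ :=
  le_norm_of_forall fun _ hS => norm_toOp_le_of_mem hS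

theorem norm_smul_le' (c : ℝ) (T : RegOp E) : ‖c • T‖ ≤ ‖c‖ * ‖T‖ := by
  rcases eq_or_ne c 0 with rfl | hc
  · have h0 : (0 : E →L[ℝ] E) ∈ dominants ((0 : ℝ) • T) := fun x _ => by simp
    simpa using norm_le_of_mem h0
  · rw [← div_le_iff₀' (norm_pos_iff.mpr hc)]
    refine le_norm_of_forall fun S hS => ?_
    rw [div_le_iff₀' (norm_pos_iff.mpr hc)]
    have hm : |c| • S ∈ dominants (c • T) := by
      intro x hx
      obtain ⟨h1, h2⟩ := hS x hx
      change c • toOp T x ≤ |c| • S x ∧ -(c • toOp T x) ≤ |c| • S x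
      rcases le_total c 0 with h | h
      · rw [abs_of_nonpos h]
        have h1' := smul_le_smul_of_nonneg_left h1 (neg_nonneg.mpr h)
        have h2' := smul_le_smul_of_nonneg_left h2 (neg_nonneg.mpr h)
        rw [neg_smul, neg_smul] at h1'
        rw [smul_neg, neg_smul, neg_neg] at h2'
        exact ⟨h2', by rwa [neg_smul]⟩
      · rw [abs_of_nonneg h]
        have h2' := smul_le_smul_of_nonneg_left h2 h
        rw [smul_neg] at h2'
        exact ⟨smul_le_smul_of_nonneg_left h1 h, h2'⟩
    refine (norm_le_of_mem hm).trans_eq ?_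
    rw [norm_smul, Real.norm_eq_abs, Real.norm_eq_abs, abs_abs]

theorem normCore [HasSolidNorm E] : NormedSpace.Core ℝ (RegOp E) where
  norm_nonneg T := le_norm_of_forall fun S _ => norm_nonneg S
  norm_smul c T := by
    refine (norm_smul_le' c T).antisymm ?_
    rcases eq_or_ne c 0 with rfl | hc
    · rw [norm_zero, zero_mul]
      exact le_norm_of_forall fun S _ => norm_nonneg S
    · have h := norm_smul_le' c⁻¹ (c • T)
      rw [inv_smul_smul₀ hc, norm_inv] at h
      rwa [← le_inv_mul_iff₀ (norm_pos_iff.mpr hc)]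
  norm_triangle S T := by
    rw [← sub_le_iff_le_add]
    refine le_norm_of_forall fun A hA => ?_
    rw [sub_le_comm]
    refine le_norm_of_forall fun B hB => ?_
    rw [sub_le_iff_le_add']
    have hm : A + B ∈ dominants (S + T) := by
      intro x hx
      obtain ⟨h1, h2⟩ := hA x hx
      obtain ⟨h3, h4⟩ := hB x hx
      change toOp S x + toOp T x ≤ A x + B x ∧ -(toOp S x + toOp T x) ≤ A x + B x
      refine ⟨add_le_add h1 h3, ?_⟩
      rw [neg_add]
      exact add_le_add h2 h4
    exact (norm_le_of_mem hm).trans (norm_add_le A B)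
  norm_eq_zero_iff T := by
    constructor
    · intro h
      refine toOp_injective (norm_le_zero_iff.mp ?_)
      exact (norm_toOp_le T).trans h.le
    · rintro rfl
      have h0 : (0 : E →L[ℝ] E) ∈ dominants (0 : RegOp E) := fun x _ => by simp
      refine le_antisymm ((norm_le_of_mem h0).trans_eq norm_zero) ?_
      exact le_norm_of_forall fun S _ => norm_nonneg S

noncomputable instance instNormedAddCommGroup [HasSolidNorm E] : NormedAddCommGroup (RegOp E) :=
  NormedAddCommGroup.ofCore normCore

noncomputable instance instNormedSpace [HasSolidNorm E] : NormedSpace ℝ (RegOp E) :=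
  NormedSpace.ofCore normCore

end RegOp

/-- `r-l-Lwc(E)`, as a subset of `L_r(E)`. -/
def rLLwc : Set (RegOp E) :=
  {T | IsRegularIn {S : E →L[ℝ] E | IsLLwc S} T.toOp}

/-- `r-l-Mwc(E)`, as a subset of `L_r(E)`. -/
def rLMwc : Set (RegOp E) :=
  {T | IsRegularIn {S : E →L[ℝ] E | IsLMwc S} T.toOp}

end Regular

/-- `L` is the lattice structure of the operator order on `L_r(E)`, and it makes `L_r(E)` with the
regular norm a Banach lattice. -/
def IsRegOpBanachLattice {E : Type*} [NormedAddCommGroup E] [NormedSpace ℝ E] [Lattice E]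
    [IsOrderedAddMonoid E] [IsOrderedModule ℝ E] [HasSolidNorm E] (L : Lattice (RegOp E)) : Prop :=
  L.toSemilatticeSup.toPartialOrder = RegOp.instPartialOrder ∧
    @HasSolidNorm (RegOp E) RegOp.instNormedAddCommGroup L ∧ CompleteSpace (RegOp E)

/-- Closed order ideals of a normed vector lattice: norm-closed solid vector subspaces. -/
def IsClosedOrderIdeal {V : Type*} [NormedAddCommGroup V] [NormedSpace ℝ V] [Lattice V]
    (I : Set V) : Prop :=
  (∃ p : Submodule ℝ V, (p : Set V) = I) ∧ LatticeOrderedAddCommGroup.IsSolid I ∧ IsClosed I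

/-!
A bounded operator `T` is l-Lwc exactly when its range lies in the order continuous part
`F^a = {u | {u} is an Lwc set}`. Singletons are limited, so the range condition is necessary.
Conversely, let `A` be limited and let `(y n)` be a disjoint sequence with `|y n| ≤ |T (a n)|`,
`a n ∈ A`. Hahn–Banach applied to the seminorm of the band generated by `y n` gives functionals
`f n` with `‖y n‖ ≤ f n (T (a n))` and `f n u → 0` for all `u ∈ F^a`; so the functionals `f n ∘ T`
form a weak*-null sequence, and limitedness of `A` forces `‖y n‖ → 0`. Since `F^a` is a closed
ideal, the l-Lwc operators form a closed subspace that is stable under positive domination and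
under composition on the right.

The l-Mwc operators form a closed subspace stable under composition on the left, and they are
stable under positive domination because every functional on a normed lattice is regular.

By Riesz–Kantorovich, `L_r(E)` is a lattice when `E` is Dedekind complete, and for a subspace with
the domination property the differences of positive members are then the `T` with `|T|` in the
subspace. Hence they form a solid set, and it is closed because `T ↦ |T|` is continuous.
-/

/-! ### Vector lattices -/

section VectorLattice

open scoped Pointwise

variable {F : Type*} [AddCommGroup F] [Lattice F]

section Module

variable [Module ℝ F] [IsOrderedModule ℝ F]

theorem smul_inf_of_nonneg {r : ℝ} (hr : 0 ≤ r) (a b : F) : r • (a ⊓ b) = r • a ⊓ r • b := by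
  rcases hr.eq_or_lt with rfl | hr
  · simp only [zero_smul, inf_idem]
  · exact (OrderIso.smulRight (β := F) hr).map_inf a b

theorem smul_sup_of_nonneg {r : ℝ} (hr : 0 ≤ r) (a b : F) : r • (a ⊔ b) = r • a ⊔ r • b := by
  rcases hr.eq_or_lt with rfl | hr
  · simp only [zero_smul, sup_idem]
  · exact (OrderIso.smulRight (β := F) hr).map_sup a b

theorem smul_Icc_zero {r : ℝ} (hr : 0 < r) (a : F) :
    r • Set.Icc 0 a = Set.Icc 0 (r • a) := by
  have h := (OrderIso.smulRight (β := F) hr).image_Icc 0 a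
  rwa [OrderIso.smulRight_apply, OrderIso.smulRight_apply, smul_zero] at h

theorem abs_real_smul (r : ℝ) (a : F) : |r • a| = |r| • |a| := by
  have abs_smul_of_nonneg {s : ℝ} (hs : 0 ≤ s) : |s • a| = s • |a| := by
    rw [abs, abs, smul_sup_of_nonneg hs, smul_neg]
  rcases abs_cases r with ⟨hr, h⟩ | ⟨hr, h⟩
  · rw [hr, abs_smul_of_nonneg h]
  · rw [hr, ← abs_smul_of_nonneg (neg_nonneg.mpr h.le), neg_smul, abs_neg]

end Module

variable [IsOrderedAddMonoid F] {a b c : F}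

theorem sub_inf_le_of_le_add (hc : 0 ≤ c) (h : a ≤ b + c) : a - a ⊓ b ≤ c := by
  rw [sub_le_comm]
  exact le_inf (sub_le_self _ hc) (sub_le_iff_le_add.mpr h)

theorem add_inf_le_inf_add_inf (ha : 0 ≤ a) (hb : 0 ≤ b) (hc : 0 ≤ c) :
    (a + b) ⊓ c ≤ a ⊓ c + b ⊓ c := by
  rw [← sub_le_iff_le_add]
  refine le_inf ?_ ((sub_le_self _ (le_inf hb hc)).trans inf_le_right)
  rw [sub_le_iff_le_add, add_inf]
  exact le_inf inf_le_left (inf_le_right.trans (le_add_of_nonneg_left ha))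

theorem abs_inf_of_nonneg (ha : 0 ≤ a) (hb : 0 ≤ b) : |a ⊓ b| = a ⊓ b :=
  abs_of_nonneg (le_inf ha hb)

theorem Icc_zero_add_Icc_zero (ha : 0 ≤ a) (hb : 0 ≤ b) :
    Set.Icc 0 a + Set.Icc 0 b = Set.Icc 0 (a + b) := by
  refine Set.Subset.antisymm ?_ fun z ⟨hz, hzab⟩ => ?_
  · simpa only [add_zero] using Set.Icc_add_Icc_subset (0 : F) a 0 b
  · exact ⟨z ⊓ a, ⟨le_inf hz ha, inf_le_right⟩, z - z ⊓ a,
      ⟨sub_nonneg.mpr inf_le_left, sub_inf_le_of_le_add hb hzab⟩, add_sub_cancel _ _⟩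

theorem IsDisjointSeq.of_abs_le {x y : ℕ → F} (hx : IsDisjointSeq x)
    (h : ∀ n, |y n| ≤ |x n|) : IsDisjointSeq y := fun m n hmn =>
  le_antisymm ((inf_le_inf (h m) (h n)).trans_eq (hx m n hmn))
    (le_inf (abs_nonneg _) (abs_nonneg _))

theorem IsDisjointSeq.abs {x : ℕ → F} (hx : IsDisjointSeq x) :
    IsDisjointSeq fun n => |x n| := hx.of_abs_le fun n => (abs_abs (x n)).le

variable [Module ℝ F] [IsOrderedModule ℝ F]

theorem smul_inf_smul_le {r s : ℝ} (hr : 0 ≤ r) (hs : 0 ≤ s) (ha : 0 ≤ a) (hb : 0 ≤ b) :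
    r • a ⊓ s • b ≤ (r + s) • (a ⊓ b) := by
  rw [smul_inf_of_nonneg (add_nonneg hr hs)]
  exact inf_le_inf (smul_le_smul_of_nonneg_right (le_add_of_nonneg_right hs) ha)
    (smul_le_smul_of_nonneg_right (le_add_of_nonneg_left hr) hb)

theorem IsDisjointSeq.smul {x : ℕ → F} (hx : IsDisjointSeq x) (t : ℕ → ℝ) :
    IsDisjointSeq fun n => t n • x n := fun m n hmn => by
  refine le_antisymm ?_ (le_inf (abs_nonneg _) (abs_nonneg _))
  calc |t m • x m| ⊓ |t n • x n| = |t m| • |x m| ⊓ |t n| • |x n| := by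
        rw [abs_real_smul, abs_real_smul]
    _ ≤ (|t m| + |t n|) • (|x m| ⊓ |x n|) :=
        smul_inf_smul_le (abs_nonneg _) (abs_nonneg _) (abs_nonneg _) (abs_nonneg _)
    _ = 0 := by rw [hx m n hmn, smul_zero]

end VectorLattice

/-! ### The order continuous part -/

theorem isClosed_setOf_tendsto_of_lipschitzWith {ι α β : Type*} [PseudoMetricSpace α]
    [PseudoMetricSpace β] {l : Filter ι} {G : ι → α → β} {K : NNReal}
    (hG : ∀ i, LipschitzWith K (G i)) (b : β) :
    IsClosed {a | Tendsto (fun i => G i a) l (𝓝 b)} :=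
  (LipschitzWith.uniformEquicontinuous G K hG).equicontinuous.isClosed_setOfPred_tendsto
    continuous_const

section OrderContinuousPart

variable {F : Type*} [NormedAddCommGroup F] [Lattice F] [HasSolidNorm F]

theorem squeeze_zero_abs {ι : Type*} {l : Filter ι} {f g : ι → F} (h : ∀ i, |f i| ≤ |g i|)
    (hg : Tendsto g l (𝓝 0)) : Tendsto f l (𝓝 0) :=
  squeeze_zero_norm (fun i => norm_le_norm_of_abs_le_abs (h i))
    (tendsto_zero_iff_norm_tendsto_zero.mp hg)

variable [IsOrderedAddMonoid F]

theorem isLwcSet_singleton_iff {u : F} : IsLwcSet {u} ↔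
    ∀ x : ℕ → F, IsDisjointSeq x → Tendsto (fun n => |x n| ⊓ |u|) atTop (𝓝 0) := by
  have abs_inf_abs (v w : F) : |(|v| ⊓ |w|)| = |v| ⊓ |w| :=
    abs_inf_of_nonneg (abs_nonneg v) (abs_nonneg w)
  refine ⟨fun hu x hx => ?_, fun hu x hxu hx => ?_⟩
  · exact hu _ (fun n => ⟨u, rfl, (abs_inf_abs _ _).trans_le inf_le_right⟩)
      (hx.of_abs_le fun n => (abs_inf_abs _ _).trans_le inf_le_left)
  · refine squeeze_zero_abs (fun n => ?_) (hu x hx)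
    obtain ⟨_, rfl, hn⟩ := hxu n
    rw [abs_inf_abs, inf_eq_left.mpr hn]

variable [NormedSpace ℝ F] [IsOrderedModule ℝ F]

variable (F) in
/-- The order continuous part `F^a` of a normed lattice, the largest ideal on which the norm is
order continuous; it is encoded through its description by disjoint sequences. -/
def orderContinuousPart : Submodule ℝ F where
  carrier := {u | IsLwcSet {u}}
  zero_mem' := isLwcSet_singleton_iff.mpr fun x _ => by
    simp only [abs_zero, inf_eq_right.mpr (abs_nonneg _), tendsto_const_nhds]
  add_mem' := fun hu hv => isLwcSet_singleton_iff.mpr fun x hx => by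
    have huv := (isLwcSet_singleton_iff.mp hu x hx).add (isLwcSet_singleton_iff.mp hv x hx)
    rw [add_zero] at huv
    refine squeeze_zero_abs (fun n => ?_) huv
    refine (abs_inf_of_nonneg (abs_nonneg _) (abs_nonneg _)).trans_le (le_trans ?_ (le_abs_self _))
    simp only [inf_comm |x n|]
    exact (inf_le_inf_right _ (abs_add_le _ _)).trans
      (add_inf_le_inf_add_inf (abs_nonneg _) (abs_nonneg _) (abs_nonneg _))
  smul_mem' := fun r _ hu => isLwcSet_singleton_iff.mpr fun x hx => by
    have hru := (isLwcSet_singleton_iff.mp hu x hx).const_smul (1 + |r|)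
    rw [smul_zero] at hru
    refine squeeze_zero_abs (fun n => ?_) hru
    refine (abs_inf_of_nonneg (abs_nonneg _) (abs_nonneg _)).trans_le (le_trans ?_ (le_abs_self _))
    simpa only [abs_real_smul, one_smul] using
      smul_inf_smul_le zero_le_one (abs_nonneg r) (abs_nonneg _) (abs_nonneg _)

theorem mem_orderContinuousPart_iff {u : F} : u ∈ orderContinuousPart F ↔
    ∀ x : ℕ → F, IsDisjointSeq x → Tendsto (fun n => |x n| ⊓ |u|) atTop (𝓝 0) :=
  isLwcSet_singleton_iff

theorem isSolid_orderContinuousPart :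
    LatticeOrderedAddCommGroup.IsSolid (orderContinuousPart F : Set F) := fun _ hu _ hvu =>
  mem_orderContinuousPart_iff.mpr fun x hx =>
    squeeze_zero_abs
      (fun _ => abs_le_abs_of_nonneg (le_inf (abs_nonneg _) (abs_nonneg _))
        (inf_le_inf_left _ hvu))
      (mem_orderContinuousPart_iff.mp hu x hx)

theorem isClosed_orderContinuousPart : IsClosed (orderContinuousPart F : Set F) := by
  have lipschitz_abs_inf_abs (y : F) : LipschitzWith 1 fun u : F => |y| ⊓ |u| :=
    LipschitzWith.of_dist_le_mul fun u v => by
      rw [NNReal.coe_one, one_mul, dist_eq_norm, dist_eq_norm, inf_comm |y|, inf_comm |y|]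
      exact (norm_inf_sub_inf_le_norm _ _ _).trans (norm_abs_sub_abs u v)
  have h : (orderContinuousPart F : Set F) = ⋂ (x : ℕ → F) (_ : IsDisjointSeq x),
      {u | Tendsto (fun n => |x n| ⊓ |u|) atTop (𝓝 0)} := by
    ext u
    simp only [SetLike.mem_coe, mem_orderContinuousPart_iff, Set.mem_iInter, Set.mem_ofPred_eq]
  rw [h]
  exact isClosed_biInter fun x _ =>
    isClosed_setOf_tendsto_of_lipschitzWith (fun n => lipschitz_abs_inf_abs (x n)) 0

end OrderContinuousPart

/-! ### The seminorm of the band generated by an element -/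

theorem exists_strongDual_apply_eq_seminorm {V : Type*} [AddCommGroup V] [TopologicalSpace V]
    [IsTopologicalAddGroup V] [Module ℝ V] [PolynormableSpace ℝ V] {p : Seminorm ℝ V}
    (hp : Continuous p) (z : V) :
    ∃ f : StrongDual ℝ V, f z = p z ∧ ∀ w, |f w| ≤ p w := by
  rcases eq_or_ne z 0 with rfl | hz
  · exact ⟨0, (map_zero p).symm, fun w => by simp⟩
  let f₀ : V →ₗ.[ℝ] ℝ := LinearPMap.mkSpanSingleton z (p z) hz
  have hf₀ (w) : f₀.toFun w ≤ p w := by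
    obtain ⟨_, hw⟩ := w
    obtain ⟨c, rfl⟩ := Submodule.mem_span_singleton.mp hw
    calc f₀.toFun ⟨c • z, hw⟩ = c * p z := LinearPMap.mkSpanSingleton'_apply ..
      _ ≤ |c| * p z := mul_le_mul_of_nonneg_right (le_abs_self c) (apply_nonneg p z)
      _ = p (c • z) := (map_smul_eq_mul p c z).symm
  obtain ⟨f, hf, hfp⟩ :=
    Module.Dual.exists_continuous_extension_of_le_seminorm_real f₀.domain f₀.toFun hp hf₀
  refine ⟨f, ?_, hfp⟩
  exact (hf ⟨z, Submodule.mem_span_singleton_self z⟩).trans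
    (LinearPMap.mkSpanSingleton_apply ..)

section Band

open scoped NNReal

variable {F : Type*} [NormedAddCommGroup F] [NormedSpace ℝ F] [Lattice F] [IsOrderedAddMonoid F]
  [IsOrderedModule ℝ F] [HasSolidNorm F]

theorem norm_inf_smul_abs_le (y z : F) (t : ℝ≥0) : ‖|z| ⊓ (t : ℝ) • |y|‖ ≤ ‖z‖ :=
  norm_le_norm_of_abs_le_abs <|
    (abs_inf_of_nonneg (abs_nonneg z) (smul_nonneg t.coe_nonneg (abs_nonneg y))).trans_le
      inf_le_left

theorem norm_inf_smul_abs_le_ciSup (y z : F) (t : ℝ≥0) :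
    ‖|z| ⊓ (t : ℝ) • |y|‖ ≤ ⨆ s : ℝ≥0, ‖|z| ⊓ (s : ℝ) • |y|‖ :=
  le_ciSup (f := fun s : ℝ≥0 => ‖|z| ⊓ (s : ℝ) • |y|‖)
    ⟨‖z‖, Set.forall_mem_range.mpr (norm_inf_smul_abs_le y z)⟩ t

/-- The seminorm `z ↦ sup_t ‖|z| ∧ t|y|‖`. When the band generated by `y` is a projection band with
projection `P` and the norm has the Fatou property, it is `z ↦ ‖P z‖`; the supremum makes sense in
every normed lattice. -/
noncomputable def bandSeminorm (y : F) : Seminorm ℝ F :=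
  Seminorm.ofSMulLE (fun z => ⨆ t : ℝ≥0, ‖|z| ⊓ (t : ℝ) • |y|‖)
    (le_antisymm (ciSup_le fun t => (norm_inf_smul_abs_le y 0 t).trans_eq norm_zero)
      (Real.iSup_nonneg fun _ => norm_nonneg _))
    (fun z w => ciSup_le fun t => by
      have ht : 0 ≤ (t : ℝ) • |y| := smul_nonneg t.coe_nonneg (abs_nonneg y)
      have hle : |z + w| ⊓ (t : ℝ) • |y| ≤ |z| ⊓ (t : ℝ) • |y| + |w| ⊓ (t : ℝ) • |y| :=
        (inf_le_inf_right _ (abs_add_le z w)).trans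
          (add_inf_le_inf_add_inf (abs_nonneg z) (abs_nonneg w) ht)
      calc ‖|z + w| ⊓ (t : ℝ) • |y|‖ ≤ ‖|z| ⊓ (t : ℝ) • |y| + |w| ⊓ (t : ℝ) • |y|‖ :=
            norm_le_norm_of_abs_le_abs (abs_le_abs_of_nonneg (le_inf (abs_nonneg _) ht) hle)
        _ ≤ ‖|z| ⊓ (t : ℝ) • |y|‖ + ‖|w| ⊓ (t : ℝ) • |y|‖ := norm_add_le _ _
        _ ≤ _ := add_le_add (norm_inf_smul_abs_le_ciSup y z t) (norm_inf_smul_abs_le_ciSup y w t))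
    (fun r z => ciSup_le fun t => by
      rcases eq_or_ne r 0 with rfl | hr
      · simpa using norm_inf_smul_abs_le y (0 : F) t
      have hscale : |r • z| ⊓ (t : ℝ) • |y| = |r| • (|z| ⊓ ((‖r‖₊⁻¹ * t : ℝ≥0) : ℝ) • |y|) := by
        rw [smul_inf_of_nonneg (abs_nonneg r), abs_real_smul, smul_smul, NNReal.coe_mul,
          NNReal.coe_inv, coe_nnnorm, Real.norm_eq_abs, mul_inv_cancel_left₀ (abs_ne_zero.mpr hr)]
      rw [hscale, norm_smul, norm_abs_eq_norm]
      exact mul_le_mul_of_nonneg_left (norm_inf_smul_abs_le_ciSup y z _) (norm_nonneg r))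

theorem bandSeminorm_le_norm (y z : F) : bandSeminorm y z ≤ ‖z‖ :=
  ciSup_le (norm_inf_smul_abs_le y z)

theorem continuous_bandSeminorm (y : F) : Continuous (bandSeminorm y) :=
  Seminorm.continuous_of_le (q := normSeminorm ℝ F) continuous_norm (bandSeminorm_le_norm y)

theorem norm_le_bandSeminorm {y z : F} (h : |y| ≤ |z|) : ‖y‖ ≤ bandSeminorm y z := by
  have h1 := norm_inf_smul_abs_le_ciSup y z 1
  rwa [NNReal.coe_one, one_smul, inf_eq_right.mpr h, norm_abs_eq_norm] at h1

theorem tendsto_bandSeminorm_zero {y : ℕ → F} (hy : IsDisjointSeq y) {u : F}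
    (hu : u ∈ orderContinuousPart F) : Tendsto (fun n => bandSeminorm (y n) u) atTop (𝓝 0) := by
  have hex (n : ℕ) : ∃ t : ℝ≥0,
      bandSeminorm (y n) u - 1 / ((n : ℝ) + 1) < ‖|u| ⊓ (t : ℝ) • |y n|‖ :=
    exists_lt_of_lt_ciSup (sub_lt_self _ Nat.one_div_pos_of_nat)
  choose t ht using hex
  have hmeet : Tendsto (fun n => |u| ⊓ (t n : ℝ) • |y n|) atTop (𝓝 0) := by
    have h := mem_orderContinuousPart_iff.mp hu _ (hy.smul fun n => (t n : ℝ))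
    simpa only [abs_real_smul, NNReal.abs_eq, inf_comm] using h
  have hbound := hmeet.norm.add (tendsto_one_div_add_atTop_nhds_zero_nat (𝕜 := ℝ))
  rw [norm_zero, add_zero] at hbound
  exact squeeze_zero (fun n => apply_nonneg _ _) (fun n => (sub_lt_iff_lt_add.mp (ht n)).le) hbound

end Band

/-! ### Positive operators -/

section PositiveOperators

theorem abs_map_le_map_abs {E F Φ : Type*} [AddCommGroup E] [Lattice E] [AddCommGroup F]
    [Lattice F] [FunLike Φ E F] [AddMonoidHomClass Φ E F] {φ : Φ} (hφ : Monotone φ) (x : E) :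
    |φ x| ≤ φ |x| :=
  abs_le'.mpr ⟨hφ (le_abs_self x), by
    rw [← map_neg]
    exact hφ (neg_le_abs x)⟩

variable {D E F : Type*} [NormedAddCommGroup D] [NormedSpace ℝ D] [Lattice D]
  [NormedAddCommGroup E] [NormedSpace ℝ E] [Lattice E]
  [NormedAddCommGroup F] [NormedSpace ℝ F] [Lattice F]

/-- `P` has the domination property if every positive operator dominated by a member of `P` is in
`P`. -/
def HasDominationProperty (P : Set (E →L[ℝ] F)) : Prop :=
  ∀ ⦃T⦄, T ∈ P → ∀ ⦃S⦄, IsPositiveOp S → (∀ x, 0 ≤ x → S x ≤ T x) → S ∈ P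

theorem isPositiveOp_zero : IsPositiveOp (0 : E →L[ℝ] F) := fun _ _ => le_rfl

theorem IsPositiveOp.comp {S : E →L[ℝ] F} {T : D →L[ℝ] E} (hS : IsPositiveOp S)
    (hT : IsPositiveOp T) : IsPositiveOp (S.comp T) := fun x hx => hS _ (hT x hx)

theorem IsPositiveOp.smul [IsOrderedModule ℝ F] {T : E →L[ℝ] F} (hT : IsPositiveOp T) {c : ℝ}
    (hc : 0 ≤ c) : IsPositiveOp (c • T) := fun x hx => smul_nonneg hc (hT x hx)

variable [IsOrderedAddMonoid F]

theorem IsPositiveOp.add {S T : E →L[ℝ] F} (hS : IsPositiveOp S) (hT : IsPositiveOp T) :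
    IsPositiveOp (S + T) := fun x hx => add_nonneg (hS x hx) (hT x hx)

theorem abs_apply_le_of_hasSum [HasSolidNorm F] {ι : Type*} {t s : ι → E →L[ℝ] F}
    {T S : E →L[ℝ] F} (ht : HasSum t T) (hs : HasSum s S)
    (hts : ∀ i x, 0 ≤ x → |t i x| ≤ s i x) (x : E) (hx : 0 ≤ x) : |T x| ≤ S x := by
  have htx : HasSum (fun i => t i x) (T x) := ht.mapL (ContinuousLinearMap.apply ℝ F x)
  have hsx : HasSum (fun i => s i x) (S x) := hs.mapL (ContinuousLinearMap.apply ℝ F x)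
  exact abs_le'.mpr ⟨hasSum_le (fun i => (le_abs_self _).trans (hts i x hx)) htx hsx,
    hasSum_le (fun i => (neg_le_abs _).trans (hts i x hx)) htx.neg hsx⟩

variable [IsOrderedAddMonoid E]

theorem IsPositiveOp.monotone {T : E →L[ℝ] F} (hT : IsPositiveOp T) : Monotone T :=
  (monotone_iff_map_nonneg T).mpr hT

theorem IsPositiveOp.abs_apply_le {T : E →L[ℝ] F} (hT : IsPositiveOp T) (x : E) :
    |T x| ≤ T |x| :=
  abs_map_le_map_abs hT.monotone x

theorem IsPositiveOp.abs_sub_apply_le {S T : E →L[ℝ] F} (hS : IsPositiveOp S)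
    (hT : IsPositiveOp T) (x : E) : |(S - T) x| ≤ (S + T) |x| :=
  calc |(S - T) x| ≤ |S x| + |T x| := by
        rw [sub_apply, sub_eq_add_neg, ← abs_neg (T x)]
        exact abs_add_le _ _
    _ ≤ (S + T) |x| := add_le_add (hS.abs_apply_le x) (hT.abs_apply_le x)

theorem IsPositiveOp.mem_upperBounds_image_Icc {S T : E →L[ℝ] F} (hS : IsPositiveOp S)
    (hTS : ∀ x, 0 ≤ x → T x ≤ S x) (x : E) : S x ∈ upperBounds (T '' Set.Icc 0 x) := by
  rintro _ ⟨y, ⟨hy, hyx⟩, rfl⟩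
  exact (hTS y hy).trans (hS.monotone hyx)

end PositiveOperators

/-! ### l-Lwc operators -/

section LLwc

variable {X : Type*} [NormedAddCommGroup X] [NormedSpace ℝ X]

theorem tendsto_weakDual_zero_iff {f : ℕ → WeakDual ℝ X} :
    Tendsto f atTop (𝓝 0) ↔ ∀ x, Tendsto (fun n => f n x) atTop (𝓝 0) :=
  tendsto_iff_forall_eval_tendsto_topDualPairing

theorem isLimitedSet_singleton (x : X) : IsLimitedSet {x} :=
  ⟨Bornology.isBounded_singleton, fun _ hf =>
    tendstoUniformlyOn_singleton_iff_tendsto.mpr (tendsto_weakDual_zero_iff.mp hf x)⟩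

theorem IsLimitedSet.tendsto_apply_zero {A : Set X} (hA : IsLimitedSet A)
    {f : ℕ → StrongDual ℝ X} (hf : ∀ x, Tendsto (fun n => f n x) atTop (𝓝 0)) {a : ℕ → X}
    (ha : ∀ n, a n ∈ A) : Tendsto (fun n => f n (a n)) atTop (𝓝 0) := by
  have hu := Metric.tendstoUniformlyOn_iff.mp
    (hA.2 (fun n => StrongDual.toWeakDual (f n)) (tendsto_weakDual_zero_iff.mpr hf))
  refine Metric.tendsto_nhds.mpr fun ε hε => (hu ε hε).mono fun n hn => ?_
  rw [dist_comm]
  exact hn (a n) (ha n)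

variable {F : Type*} [NormedAddCommGroup F]
  [NormedSpace ℝ F] [Lattice F] [IsOrderedAddMonoid F] [IsOrderedModule ℝ F] [HasSolidNorm F]

theorem isLLwc_iff {T : X →L[ℝ] F} : IsLLwc T ↔ ∀ x, T x ∈ orderContinuousPart F := by
  refine ⟨fun hT x => ?_, fun hT A hA y hyA hy => ?_⟩
  · have h : IsLwcSet (T '' {x}) := hT {x} (isLimitedSet_singleton x)
    rwa [Set.image_singleton] at h
  have hex (n : ℕ) : ∃ a ∈ A, |y n| ≤ |T a| := by
    obtain ⟨_, ⟨a, ha, rfl⟩, hya⟩ := hyA n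
    exact ⟨a, ha, hya⟩
  choose a haA hya using hex
  choose f hfa hf using fun n =>
    exists_strongDual_apply_eq_seminorm (continuous_bandSeminorm (y n)) (T (a n))
  have hfT (x : X) : Tendsto (fun n => (f n).comp T x) atTop (𝓝 0) :=
    squeeze_zero_norm (fun n => hf n (T x)) (tendsto_bandSeminorm_zero hy (hT x))
  refine squeeze_zero_norm (fun n => ?_) (hA.tendsto_apply_zero hfT haA)
  exact (norm_le_bandSeminorm (hya n)).trans_eq (hfa n).symm

variable (X F) in
/-- The subspace of l-Lwc operators. -/
def lLwc : Submodule ℝ (X →L[ℝ] F) where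
  carrier := {T | IsLLwc T}
  zero_mem' := isLLwc_iff.mpr fun _ => zero_mem _
  add_mem' hS hT := isLLwc_iff.mpr fun x => add_mem (isLLwc_iff.mp hS x) (isLLwc_iff.mp hT x)
  smul_mem' c _ hT := isLLwc_iff.mpr fun x => Submodule.smul_mem _ c (isLLwc_iff.mp hT x)

theorem IsLLwc.comp {Z : Type*} [NormedAddCommGroup Z] [NormedSpace ℝ Z] {T : X →L[ℝ] F}
    (hT : IsLLwc T) (S : Z →L[ℝ] X) : IsLLwc (T.comp S) :=
  isLLwc_iff.mpr fun x => isLLwc_iff.mp hT (S x)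

theorem isClosed_lLwc : IsClosed (lLwc X F : Set (X →L[ℝ] F)) := by
  have h : (lLwc X F : Set (X →L[ℝ] F)) = ⋂ x, {T | T x ∈ orderContinuousPart F} := by
    ext T
    rw [Set.mem_iInter]
    exact isLLwc_iff
  rw [h]
  exact isClosed_iInter fun x => isClosed_orderContinuousPart.preimage
    (ContinuousLinearMap.apply ℝ F x).continuous

theorem hasDominationProperty_lLwc {E : Type*} [NormedAddCommGroup E] [NormedSpace ℝ E]
    [Lattice E] [IsOrderedAddMonoid E] :
    HasDominationProperty (lLwc E F : Set (E →L[ℝ] F)) := fun T hT S hS hST =>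
  isLLwc_iff.mpr fun x => isSolid_orderContinuousPart (isLLwc_iff.mp hT |x|) <|
    calc |S x| ≤ S |x| := hS.abs_apply_le x
      _ ≤ T |x| := hST _ (abs_nonneg x)
      _ ≤ |(T |x|)| := le_abs_self _

end LLwc

/-! ### The Riesz–Kantorovich theorem -/

section RieszKantorovich

open scoped Pointwise

theorem map_posPart_sub_map_negPart_of_add {E F : Type*} [AddCommGroup E] [Lattice E]
    [IsOrderedAddMonoid E] [AddCommGroup F] {p : E → F}
    (hadd : ∀ x y, 0 ≤ x → 0 ≤ y → p (x + y) = p x + p y) {u v : E} (hu : 0 ≤ u) (hv : 0 ≤ v) :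
    p (u - v)⁺ - p (u - v)⁻ = p u - p v := by
  have h : (u - v)⁺ + v = u + (u - v)⁻ :=
    sub_eq_sub_iff_add_eq_add.mp (posPart_sub_negPart (u - v))
  rw [sub_eq_sub_iff_add_eq_add, ← hadd _ _ (posPart_nonneg _) hv, h,
    hadd _ _ hu (negPart_nonneg _)]

section LinearMap

variable {E F : Type*} [AddCommGroup E] [Module ℝ E] [Lattice E] [IsOrderedAddMonoid E]
  [IsOrderedModule ℝ E] [AddCommGroup F] [Module ℝ F]

theorem exists_linearMap_of_add_on_nonneg (p : E → F)
    (hadd : ∀ x y, 0 ≤ x → 0 ≤ y → p (x + y) = p x + p y)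
    (hsmul : ∀ (c : ℝ) x, 0 < c → 0 ≤ x → p (c • x) = c • p x) :
    ∃ P : E →ₗ[ℝ] F, ∀ x, 0 ≤ x → P x = p x := by
  have hp0 : p 0 = 0 := by simpa using hadd 0 0 le_rfl le_rfl
  let P (x : E) : F := p x⁺ - p x⁻
  have hsub {u v : E} (hu : 0 ≤ u) (hv : 0 ≤ v) : P (u - v) = p u - p v :=
    map_posPart_sub_map_negPart_of_add hadd hu hv
  have hneg (x : E) : P (-x) = -P x := by
    simp only [P, posPart_neg, negPart_neg, neg_sub]
  have hsmul_pos {c : ℝ} (hc : 0 < c) (x : E) : P (c • x) = c • P x := by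
    have hx : c • x = c • x⁺ - c • x⁻ := by rw [← smul_sub, posPart_sub_negPart]
    rw [hx, hsub (smul_nonneg hc.le (posPart_nonneg x)) (smul_nonneg hc.le (negPart_nonneg x)),
      hsmul c _ hc (posPart_nonneg x), hsmul c _ hc (negPart_nonneg x), ← smul_sub]
  have hP_add (x y : E) : P (x + y) = P x + P y := by
    have hxy : x + y = (x⁺ + y⁺) - (x⁻ + y⁻) := by
      rw [add_sub_add_comm, posPart_sub_negPart, posPart_sub_negPart]
    rw [hxy, hsub (add_nonneg (posPart_nonneg x) (posPart_nonneg y))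
      (add_nonneg (negPart_nonneg x) (negPart_nonneg y)),
      hadd _ _ (posPart_nonneg x) (posPart_nonneg y),
      hadd _ _ (negPart_nonneg x) (negPart_nonneg y), add_sub_add_comm]
  have hP_smul (c : ℝ) (x : E) : P (c • x) = c • P x := by
    rcases lt_trichotomy c 0 with hc | rfl | hc
    · rw [← neg_neg (c • x), hneg, ← neg_smul, hsmul_pos (neg_pos.mpr hc), neg_smul, neg_neg]
    · simp only [P, zero_smul, posPart_zero, negPart_zero, sub_self]
    · exact hsmul_pos hc x
  refine ⟨⟨⟨P, hP_add⟩, hP_smul⟩, fun x hx => ?_⟩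
  change p x⁺ - p x⁻ = p x
  rw [posPart_of_nonneg hx, negPart_of_nonneg hx, hp0, sub_zero]

variable [Lattice F] [IsOrderedAddMonoid F] [IsOrderedModule ℝ F]

theorem exists_linearMap_isLUB (hF : IsDedekindComplete F) (T : E →ₗ[ℝ] F)
    (hT : ∀ x, 0 ≤ x → BddAbove (T '' Set.Icc 0 x)) :
    ∃ P : E →ₗ[ℝ] F, ∀ x, 0 ≤ x → IsLUB (T '' Set.Icc 0 x) (P x) := by
  choose! p hp using fun x (hx : 0 ≤ x) =>
    hF (T '' Set.Icc 0 x) ((Set.nonempty_Icc.mpr hx).image T) (hT x hx)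
  obtain ⟨P, hP⟩ := exists_linearMap_of_add_on_nonneg p
    (fun x y hx hy => by
      have h := (hp x hx).add (hp y hy)
      rw [← Set.image_add, Icc_zero_add_Icc_zero hx hy] at h
      exact (hp _ (add_nonneg hx hy)).unique h)
    (fun c x hc hx => by
      have h : IsLUB (c • (T '' Set.Icc 0 x)) (c • p x) :=
        (OrderIso.smulRight (β := F) hc).isLUB_image'.mpr (hp x hx)
      rw [← image_smul_set, smul_Icc_zero hc] at h
      exact (hp _ (smul_nonneg hc.le hx)).unique h)
  exact ⟨P, fun x hx => (hP x hx).symm ▸ hp x hx⟩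

end LinearMap

variable {E F : Type*} [NormedAddCommGroup E] [NormedSpace ℝ E] [Lattice E]
  [IsOrderedAddMonoid E] [IsOrderedModule ℝ E] [HasSolidNorm E] [NormedAddCommGroup F]
  [NormedSpace ℝ F] [Lattice F] [IsOrderedAddMonoid F] [IsOrderedModule ℝ F] [HasSolidNorm F]

theorem exists_continuousLinearMap_isLUB (hF : IsDedekindComplete F) (T : E →L[ℝ] F) {b : E → F}
    {C : ℝ} (hb : ∀ x, 0 ≤ x → b x ∈ upperBounds (T '' Set.Icc 0 x))
    (hC : ∀ x, 0 ≤ x → ‖b x‖ ≤ C * ‖x‖) :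
    ∃ P : E →L[ℝ] F, ∀ x, 0 ≤ x → IsLUB (T '' Set.Icc 0 x) (P x) := by
  obtain ⟨P, hP⟩ := exists_linearMap_isLUB hF (T : E →ₗ[ℝ] F) fun x hx => ⟨b x, hb x hx⟩
  have hP0 (x : E) (hx : 0 ≤ x) : 0 ≤ P x := (hP x hx).1 ⟨0, ⟨le_rfl, hx⟩, map_zero T⟩
  have hPb (x : E) : |P x| ≤ b |x| :=
    (abs_map_le_map_abs ((monotone_iff_map_nonneg P).mpr hP0) x).trans
      ((hP _ (abs_nonneg x)).2 (hb _ (abs_nonneg x)))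
  refine ⟨P.mkContinuous C fun x => ?_, hP⟩
  calc ‖P x‖ ≤ ‖b |x|‖ := norm_le_norm_of_abs_le_abs ((hPb x).trans (le_abs_self _))
    _ ≤ C * ‖|x|‖ := hC _ (abs_nonneg x)
    _ = C * ‖x‖ := by rw [norm_abs_eq_norm]

theorem isDedekindComplete_of_conditionallyCompleteLattice (F : Type*)
    [ConditionallyCompleteLattice F] : IsDedekindComplete F :=
  fun _ hs hb => ⟨_, isLUB_csSup hs hb⟩

theorem isRegularIn_univ_strongDual (f : StrongDual ℝ E) : IsRegularIn Set.univ f := by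
  obtain ⟨P, hP⟩ := exists_continuousLinearMap_isLUB
    (isDedekindComplete_of_conditionallyCompleteLattice ℝ) f (b := fun x => ‖f‖ * ‖x‖) (C := ‖f‖)
    (by
      rintro x - _ ⟨y, ⟨hy, hyx⟩, rfl⟩
      calc f y ≤ ‖f y‖ := le_abs_self _
        _ ≤ ‖f‖ * ‖y‖ := f.le_opNorm y
        _ ≤ ‖f‖ * ‖x‖ := mul_le_mul_of_nonneg_left
          (norm_le_norm_of_abs_le_abs (abs_le_abs_of_nonneg hy hyx)) (norm_nonneg f))
    (fun x _ => by rw [norm_mul, norm_norm, norm_norm])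
  refine ⟨P, trivial, P - f, trivial, fun x hx => ?_, fun x hx => sub_nonneg.mpr ?_,
    (sub_sub_cancel P f).symm⟩
  · exact (hP x hx).1 ⟨0, ⟨le_rfl, hx⟩, map_zero f⟩
  · exact (hP x hx).1 ⟨x, ⟨hx, le_rfl⟩, rfl⟩

end RieszKantorovich

/-! ### l-Mwc operators -/

section LMwc

theorem isBounded_range_abs {E : Type*} [NormedAddCommGroup E] [Lattice E]
    [IsOrderedAddMonoid E] [HasSolidNorm E] {x : ℕ → E}
    (hx : Bornology.IsBounded (Set.range x)) :
    Bornology.IsBounded (Set.range fun n => |x n|) := by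
  obtain ⟨M, hM⟩ := hx.exists_norm_le
  refine isBounded_iff_forall_norm_le.mpr ⟨M, Set.forall_mem_range.mpr fun n => ?_⟩
  rw [norm_abs_eq_norm]
  exact hM _ (Set.mem_range_self n)

section NormedSpace

variable {E Y Z : Type*} [NormedAddCommGroup E] [NormedSpace ℝ E] [Lattice E]
  [NormedAddCommGroup Y] [NormedSpace ℝ Y] [NormedAddCommGroup Z] [NormedSpace ℝ Z]

theorem tendsto_toWeakSpace_iff {ι : Type*} {l : Filter ι} {y : ι → Y} {a : Y} :
    Tendsto (fun i => toWeakSpace ℝ Y (y i)) l (𝓝 (toWeakSpace ℝ Y a)) ↔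
      ∀ f : StrongDual ℝ Y, Tendsto (fun i => f (y i)) l (𝓝 (f a)) :=
  WeakBilin.tendsto_iff_forall_eval_tendsto (topDualPairing ℝ Y).flip fun _ _ h =>
    SeparatingDual.eq_iff_forall_dual_eq (R := ℝ) |>.mpr fun f => LinearMap.congr_fun h f

theorem isLMwc_iff {T : E →L[ℝ] Y} : IsLMwc T ↔ ∀ x : ℕ → E, IsDisjointSeq x →
    Bornology.IsBounded (Set.range x) → ∀ f : StrongDual ℝ Y,
      Tendsto (fun n => f (T (x n))) atTop (𝓝 0) :=
  forall₃_congr fun x _ _ => by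
    simpa only [map_zero] using tendsto_toWeakSpace_iff (y := fun n => T (x n)) (a := 0)

variable (E Y) in
/-- The subspace of l-Mwc operators. -/
def lMwc : Submodule ℝ (E →L[ℝ] Y) where
  carrier := {T | IsLMwc T}
  zero_mem' _ _ _ := by simp
  add_mem' hS hT x hd hb := by simpa using (hS x hd hb).add (hT x hd hb)
  smul_mem' c _ hT x hd hb := by simpa using (hT x hd hb).const_smul c

theorem IsLMwc.comp_left {T : E →L[ℝ] Y} (hT : IsLMwc T) (S : Y →L[ℝ] Z) : IsLMwc (S.comp T) :=
  isLMwc_iff.mpr fun x hd hb f => isLMwc_iff.mp hT x hd hb (f.comp S)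

theorem isClosed_lMwc : IsClosed (lMwc E Y : Set (E →L[ℝ] Y)) := by
  have h : (lMwc E Y : Set (E →L[ℝ] Y)) =
      ⋂ (x : ℕ → E) (_ : IsDisjointSeq x) (_ : Bornology.IsBounded (Set.range x))
        (f : StrongDual ℝ Y), {T | Tendsto (fun n => f (T (x n))) atTop (𝓝 0)} := by
    ext T
    simp only [Set.mem_iInter]
    exact isLMwc_iff
  rw [h]
  refine isClosed_iInter fun x => isClosed_iInter fun _ => isClosed_iInter fun hb =>
    isClosed_iInter fun f => ?_
  obtain ⟨M, hM0, hM⟩ := hb.exists_pos_norm_le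
  refine isClosed_setOf_tendsto_of_lipschitzWith (K := ‖f‖₊ * ⟨M, hM0.le⟩)
    (fun n => LipschitzWith.of_dist_le_mul fun S T => ?_) 0
  calc dist (f (S (x n))) (f (T (x n))) = ‖f ((S - T) (x n))‖ := by
        rw [dist_eq_norm, ← map_sub, sub_apply]
    _ ≤ ‖f‖ * (‖S - T‖ * ‖x n‖) := f.le_opNorm_of_le ((S - T).le_opNorm _)
    _ ≤ ‖f‖ * (‖S - T‖ * M) := by
        gcongr
        exact hM _ (Set.mem_range_self n)
    _ = ‖f‖ * M * dist S T := by rw [dist_eq_norm, mul_comm ‖S - T‖, mul_assoc]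

end NormedSpace

variable {E F : Type*} [NormedAddCommGroup E] [NormedSpace ℝ E] [Lattice E]
  [IsOrderedAddMonoid E] [HasSolidNorm E] [NormedAddCommGroup F]
  [NormedSpace ℝ F] [Lattice F] [IsOrderedAddMonoid F] [IsOrderedModule ℝ F] [HasSolidNorm F]

theorem hasDominationProperty_lMwc : HasDominationProperty (lMwc E F : Set (E →L[ℝ] F)) := by
  refine fun T hT S hS hST => isLMwc_iff.mpr fun x hd hb f => ?_
  obtain ⟨g, -, h, -, hg, hh, rfl⟩ := isRegularIn_univ_strongDual f
  refine squeeze_zero_norm (fun n => ?_)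
    (isLMwc_iff.mp hT _ hd.abs (isBounded_range_abs hb) (g + h))
  calc ‖(g - h) (S (x n))‖ ≤ (g + h) |S (x n)| := hg.abs_sub_apply_le hh _
    _ ≤ (g + h) (T |x n|) := (hg.add hh).monotone <|
      (hS.abs_apply_le _).trans (hST _ (abs_nonneg _))

end LMwc

/-! ### Regular operators -/

section Regular

section Submodule

variable {E F : Type*} [NormedAddCommGroup E] [NormedSpace ℝ E] [Lattice E]
  [NormedAddCommGroup F] [NormedSpace ℝ F] [Lattice F] [IsOrderedAddMonoid F]
  [IsOrderedModule ℝ F]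

/-- The subspace of r-`P`-operators: the span of the positive members of `P`. -/
def regularSubmodule (P : Submodule ℝ (E →L[ℝ] F)) : Submodule ℝ (E →L[ℝ] F) where
  carrier := {T | IsRegularIn (P : Set (E →L[ℝ] F)) T}
  zero_mem' := ⟨0, P.zero_mem, 0, P.zero_mem, isPositiveOp_zero, isPositiveOp_zero,
    (sub_zero 0).symm⟩
  add_mem' := by
    rintro _ _ ⟨A, hA, B, hB, pA, pB, rfl⟩ ⟨C, hC, D, hD, pC, pD, rfl⟩
    exact ⟨A + C, P.add_mem hA hC, B + D, P.add_mem hB hD, pA.add pC, pB.add pD,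
      sub_add_sub_comm A B C D⟩
  smul_mem' := by
    rintro c _ ⟨A, hA, B, hB, pA, pB, rfl⟩
    rcases le_total 0 c with hc | hc
    · exact ⟨c • A, P.smul_mem c hA, c • B, P.smul_mem c hB, pA.smul hc, pB.smul hc,
        smul_sub c A B⟩
    · have hc' := neg_nonneg.mpr hc
      refine ⟨-c • B, P.smul_mem _ hB, -c • A, P.smul_mem _ hA, pB.smul hc', pA.smul hc', ?_⟩
      rw [← smul_sub, ← neg_sub A B, neg_smul_neg]

theorem regularSubmodule_le (P : Submodule ℝ (E →L[ℝ] F)) : regularSubmodule P ≤ P := by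
  rintro _ ⟨A, hA, B, hB, -, -, rfl⟩
  exact P.sub_mem hA hB

end Submodule

variable {E : Type*} [NormedAddCommGroup E] [NormedSpace ℝ E] [Lattice E]
  [IsOrderedAddMonoid E] [IsOrderedModule ℝ E]

theorem comp_mem_regularSubmodule {P : Submodule ℝ (E →L[ℝ] E)}
    (hP : ∀ S ∈ P, ∀ T ∈ P, S.comp T ∈ P) {S T : E →L[ℝ] E} (hS : S ∈ regularSubmodule P)
    (hT : T ∈ regularSubmodule P) : S.comp T ∈ regularSubmodule P := by
  obtain ⟨A, hA, B, hB, pA, pB, rfl⟩ := hS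
  obtain ⟨C, hC, D, hD, pC, pD, rfl⟩ := hT
  refine ⟨A.comp C + B.comp D, P.add_mem (hP _ hA _ hC) (hP _ hB _ hD),
    A.comp D + B.comp C, P.add_mem (hP _ hA _ hD) (hP _ hB _ hC),
    (pA.comp pC).add (pB.comp pD), (pA.comp pD).add (pB.comp pC), ?_⟩
  rw [ContinuousLinearMap.sub_comp, ContinuousLinearMap.comp_sub, ContinuousLinearMap.comp_sub]
  abel

namespace RegOp

/-- The inclusion of the regular operators into the bounded operators, as a linear map. -/
noncomputable def toOpₗ : RegOp E →ₗ[ℝ] E →L[ℝ] E where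
  toFun := toOp
  map_add' := toOp_add
  map_smul' := toOp_smul

/-- The subspace of r-`P`-operators of `L_r(E)`. -/
noncomputable def regularPart (P : Submodule ℝ (E →L[ℝ] E)) : Submodule ℝ (RegOp E) :=
  (regularSubmodule P).comap toOpₗ

theorem mul_mem_regularPart {P : Submodule ℝ (E →L[ℝ] E)}
    (hP : ∀ S ∈ P, ∀ T ∈ P, S.comp T ∈ P) (S T : RegOp E) (hS : S ∈ regularPart P)
    (hT : T ∈ regularPart P) : S * T ∈ regularPart P :=
  comp_mem_regularSubmodule hP hS hT

theorem regularPart_eq_univ_iff {P : Submodule ℝ (E →L[ℝ] E)}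
    (hP : ContinuousLinearMap.id ℝ E ∈ P → P = ⊤) :
    (regularPart P : Set (RegOp E)) = Set.univ ↔ ContinuousLinearMap.id ℝ E ∈ P := by
  refine ⟨fun h => ?_, fun h => Set.eq_univ_of_forall fun T => ?_⟩
  · have h1 : (1 : RegOp E) ∈ (regularPart P : Set (RegOp E)) := h ▸ Set.mem_univ _
    exact regularSubmodule_le P h1
  · rw [hP h]
    exact T.2

end RegOp

end Regular

/-! ### The Banach lattice of regular operators -/

/-- A partially ordered group in which all positive parts exist, as a lattice ordered group. -/
@[reducible] noncomputable def latticeOfIsLUB {G : Type*} [AddCommGroup G] [PartialOrder G]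
    [IsOrderedAddMonoid G] (h : ∀ a : G, ∃ b, IsLUB {a, 0} b) : Lattice G where
  __ := (inferInstance : PartialOrder G)
  sup a b := a + (h (b - a)).choose
  inf a b := a - (h (a - b)).choose
  le_sup_left a b := le_add_of_nonneg_right ((h (b - a)).choose_spec.1 (Or.inr rfl))
  le_sup_right a b := sub_le_iff_le_add'.mp ((h (b - a)).choose_spec.1 (Or.inl rfl))
  sup_le a b c ha hb := by
    rw [← le_sub_iff_add_le']
    refine (h (b - a)).choose_spec.2 ?_
    rintro _ (rfl | rfl)
    · exact sub_le_sub_right hb a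
    · exact sub_nonneg.mpr ha
  inf_le_left a b := sub_le_self _ ((h (a - b)).choose_spec.1 (Or.inr rfl))
  inf_le_right a b := sub_le_comm.mp ((h (a - b)).choose_spec.1 (Or.inl rfl))
  le_inf c a b ha hb := by
    rw [le_sub_comm]
    refine (h (a - b)).choose_spec.2 ?_
    rintro _ (rfl | rfl)
    · exact sub_le_sub_left hb a
    · exact sub_nonneg.mpr ha

namespace RegOp

section Order

variable {E : Type*} [NormedAddCommGroup E] [NormedSpace ℝ E] [Lattice E]
  [IsOrderedAddMonoid E] [IsOrderedModule ℝ E]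

theorem mem_dominants_iff {T : RegOp E} {S : E →L[ℝ] E} :
    S ∈ dominants T ↔ ∀ x, 0 ≤ x → |toOp T x| ≤ S x :=
  forall₂_congr fun _ _ => abs_le'.symm

/-- A bounded operator `T` with `± T ≤ S` for some bounded `S`, as a regular operator. -/
def ofAbsLe (T S : E →L[ℝ] E) (h : ∀ x, 0 ≤ x → |T x| ≤ S x) : RegOp E :=
  ⟨T, S, trivial, S - T, trivial, fun x hx => (abs_nonneg _).trans (h x hx),
    fun x hx => sub_nonneg.mpr ((le_abs_self _).trans (h x hx)), (sub_sub_cancel S T).symm⟩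

/-- A positive operator, as a regular operator. -/
def ofPositive (T : E →L[ℝ] E) (hT : IsPositiveOp T) : RegOp E :=
  ofAbsLe T T fun x hx => (abs_of_nonneg (hT x hx)).le

variable [HasSolidNorm E]

theorem exists_isLUB_zero (hE : IsDedekindComplete E) (T : RegOp E) :
    ∃ P : RegOp E, IsLUB {T, 0} P := by
  obtain ⟨A, -, B, -, hA, hB, hT⟩ := T.2
  have hTA (x : E) (hx : 0 ≤ x) : toOp T x ≤ A x := by
    rw [toOp, hT]
    exact sub_le_self _ (hB x hx)
  obtain ⟨P, hP⟩ := exists_continuousLinearMap_isLUB hE (toOp T)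
    (fun x _ => hA.mem_upperBounds_image_Icc hTA x) fun x _ => A.le_opNorm x
  have hP0 : IsPositiveOp P := fun x hx => (hP x hx).1 ⟨0, ⟨le_rfl, hx⟩, map_zero _⟩
  refine ⟨ofPositive P hP0, ?_, fun R hR x hx => (hP x hx).2 ?_⟩
  · rintro _ (rfl | rfl)
    · exact fun x hx => (hP x hx).1 ⟨x, ⟨hx, le_rfl⟩, rfl⟩
    · exact hP0
  · have hR0 : IsPositiveOp (toOp R) := hR (Or.inr rfl)
    exact hR0.mem_upperBounds_image_Icc (hR (Or.inl rfl)) x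

/-- The vector lattice structure of `L_r(E)` for Dedekind complete `E`. -/
@[reducible] noncomputable def latticeOfIsDedekindComplete (hE : IsDedekindComplete E) :
    Lattice (RegOp E) :=
  latticeOfIsLUB (exists_isLUB_zero hE)

theorem mem_dominants_iff_abs (hE : IsDedekindComplete E) {T : RegOp E} {S : E →L[ℝ] E} :
    letI := latticeOfIsDedekindComplete hE
    S ∈ dominants T ↔ ∀ x, 0 ≤ x → toOp |T| x ≤ S x := by
  let := latticeOfIsDedekindComplete hE
  refine mem_dominants_iff.trans ⟨fun h => ?_, fun h x hx => (h x hx).trans' ?_⟩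
  · have hS : IsPositiveOp S := fun x hx => (abs_nonneg _).trans (h x hx)
    have hle : |T| ≤ ofPositive S hS := abs_le'.mpr
      ⟨fun x hx => (le_abs_self _).trans (h x hx), fun x hx => (neg_le_abs _).trans (h x hx)⟩
    exact hle
  · exact abs_le'.mpr ⟨le_abs_self T x hx, neg_le_abs T x hx⟩

theorem hasSolidNorm (hE : IsDedekindComplete E) :
    @HasSolidNorm (RegOp E) instNormedAddCommGroup (latticeOfIsDedekindComplete hE) := by
  let := latticeOfIsDedekindComplete hE
  exact ⟨fun S T h => le_norm_of_forall fun R hR => norm_le_of_mem <|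
    (mem_dominants_iff_abs hE).mpr fun x hx =>
      (h x hx).trans ((mem_dominants_iff_abs hE).mp hR x hx)⟩

end Order

section Complete

variable {E : Type*} [NormedAddCommGroup E] [NormedSpace ℝ E] [Lattice E]
  [IsOrderedAddMonoid E] [IsOrderedModule ℝ E]

theorem exists_mem_dominants_norm_lt (T : RegOp E) {ε : ℝ} (hε : 0 < ε) :
    ∃ S ∈ dominants T, ‖S‖ < ‖T‖ + ε := by
  by_contra! h
  exact (lt_add_of_pos_right _ hε).not_ge (le_norm_of_forall h)

variable [HasSolidNorm E]

theorem tendsto_sum_of_hasSum_dominants {u : ℕ → RegOp E} {s : ℕ → E →L[ℝ] E} {T : RegOp E}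
    {S : E →L[ℝ] E} (hus : ∀ n, s n ∈ dominants (u n)) (hu : HasSum (fun n => toOp (u n)) (toOp T))
    (hs : HasSum s S) : Tendsto (fun n => ∑ i ∈ Finset.range n, u i) atTop (𝓝 T) := by
  have hlim : Tendsto (fun n => ‖S - ∑ i ∈ Finset.range n, s i‖) atTop (𝓝 0) := by
    simpa only [sub_self, norm_zero] using (hs.tendsto_sum_nat.const_sub S).norm
  refine tendsto_iff_norm_sub_tendsto_zero.mpr <|
    squeeze_zero (fun n => norm_nonneg _) (fun n => ?_) hlim
  have htail : HasSum (fun i => toOp (u (i + n))) (toOp (T - ∑ i ∈ Finset.range n, u i)) := by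
    have hsum : toOp (∑ i ∈ Finset.range n, u i) = ∑ i ∈ Finset.range n, toOp (u i) :=
      map_sum toOpₗ u _
    rw [toOp_sub, hsum]
    exact (hasSum_nat_add_iff' n).mpr hu
  rw [norm_sub_rev]
  exact norm_le_of_mem <| mem_dominants_iff.mpr <|
    abs_apply_le_of_hasSum htail ((hasSum_nat_add_iff' n).mpr hs) fun i =>
      mem_dominants_iff.mp (hus (i + n))

instance instCompleteSpace [CompleteSpace E] : CompleteSpace (RegOp E) := by
  refine NormedAddCommGroup.completeSpace_of_summable_imp_tendsto fun u hu => ?_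
  choose s hus hs using fun n =>
    exists_mem_dominants_norm_lt (u n) (pow_pos (one_half_pos (α := ℝ)) n)
  have hsS : HasSum s (∑' n, s n) :=
    (Summable.of_norm_bounded (hu.add summable_geometric_two) fun n => (hs n).le).hasSum
  have huT : HasSum (fun n => toOp (u n)) (∑' n, toOp (u n)) :=
    (Summable.of_norm_bounded hu fun n => norm_toOp_le (u n)).hasSum
  have hTS := abs_apply_le_of_hasSum huT hsS fun n => mem_dominants_iff.mp (hus n)
  exact ⟨ofAbsLe _ _ hTS, tendsto_sum_of_hasSum_dominants hus huT hsS⟩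

theorem isRegOpBanachLattice [CompleteSpace E] (hE : IsDedekindComplete E) :
    IsRegOpBanachLattice (latticeOfIsDedekindComplete hE) :=
  ⟨rfl, hasSolidNorm hE, inferInstance⟩

end Complete

/-! ### Ideals of regular operators -/

section Ideal

variable {E : Type*} [NormedAddCommGroup E] [NormedSpace ℝ E] [Lattice E]
  [IsOrderedAddMonoid E] [IsOrderedModule ℝ E] [HasSolidNorm E]

theorem continuous_toOp : Continuous (toOp (E := E)) :=
  AddMonoidHomClass.continuous_of_bound (toOpₗ (E := E)) 1 fun T => by
    rw [one_mul]
    exact norm_toOp_le T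

theorem mem_regularPart_iff_abs_mem (hE : IsDedekindComplete E) {P : Submodule ℝ (E →L[ℝ] E)}
    (hP : HasDominationProperty (P : Set (E →L[ℝ] E))) {T : RegOp E} :
    letI := latticeOfIsDedekindComplete hE
    T ∈ regularPart P ↔ toOp |T| ∈ P := by
  let := latticeOfIsDedekindComplete hE
  constructor
  · rintro ⟨A, hA, B, hB, pA, pB, hT⟩
    have hdom : A + B ∈ dominants T := mem_dominants_iff.mpr fun x hx => by
      simpa only [abs_of_nonneg hx, ← hT] using! pA.abs_sub_apply_le pB x
    exact hP (P.add_mem hA hB) (abs_nonneg T) ((mem_dominants_iff_abs hE).mp hdom)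
  · intro h
    have hpos : T⁺ ≤ |T| := sup_le (le_abs_self T) (abs_nonneg T)
    have hneg : T⁻ ≤ |T| := sup_le (neg_le_abs T) (abs_nonneg T)
    refine ⟨toOp T⁺, hP h (posPart_nonneg T) hpos, toOp T⁻, hP h (negPart_nonneg T) hneg,
      posPart_nonneg T, negPart_nonneg T, ?_⟩
    change toOp T = _
    rw [← toOp_sub, posPart_sub_negPart]

theorem isSolid_regularPart (hE : IsDedekindComplete E) {P : Submodule ℝ (E →L[ℝ] E)}
    (hP : HasDominationProperty (P : Set (E →L[ℝ] E))) :
    letI := latticeOfIsDedekindComplete hE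
    LatticeOrderedAddCommGroup.IsSolid (regularPart P : Set (RegOp E)) := by
  let := latticeOfIsDedekindComplete hE
  intro T hT S hST
  rw [SetLike.mem_coe, mem_regularPart_iff_abs_mem hE hP] at hT ⊢
  exact hP hT (abs_nonneg S) hST

theorem isClosed_regularPart (hE : IsDedekindComplete E) {P : Submodule ℝ (E →L[ℝ] E)}
    (hP : HasDominationProperty (P : Set (E →L[ℝ] E)))
    (hPc : IsClosed (P : Set (E →L[ℝ] E))) : IsClosed (regularPart P : Set (RegOp E)) := by
  let := latticeOfIsDedekindComplete hE
  have := hasSolidNorm hE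
  have hcont : Continuous fun T : RegOp E => |T| :=
    continuous_id.sup continuous_neg
  have h : (regularPart P : Set (RegOp E)) = {T | toOp |T| ∈ (P : Set (E →L[ℝ] E))} :=
    Set.ext fun _ => mem_regularPart_iff_abs_mem hE hP
  rw [h]
  exact hPc.preimage (continuous_toOp.comp hcont)

theorem isClosedOrderIdeal_regularPart (hE : IsDedekindComplete E)
    {P : Submodule ℝ (E →L[ℝ] E)} (hP : HasDominationProperty (P : Set (E →L[ℝ] E)))
    (hPc : IsClosed (P : Set (E →L[ℝ] E))) :
    @IsClosedOrderIdeal (RegOp E) _ _ (latticeOfIsDedekindComplete hE) (regularPart P) :=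
  ⟨⟨regularPart P, rfl⟩, isSolid_regularPart hE hP, isClosed_regularPart hE hP hPc⟩

end Ideal

end RegOp

theorem theorem6 (E : Type*) [NormedAddCommGroup E] [NormedSpace ℝ E] [CompleteSpace E]
    [Lattice E] [IsOrderedAddMonoid E] [IsOrderedModule ℝ E] [HasSolidNorm E] :
    (∃ A : NonUnitalSubalgebra ℝ (RegOp E), (A : Set (RegOp E)) = rLLwc E) ∧
    (∃ A : NonUnitalSubalgebra ℝ (RegOp E), (A : Set (RegOp E)) = rLMwc E) ∧
    (rLLwc E = Set.univ ↔ IsLLwc (ContinuousLinearMap.id ℝ E)) ∧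
    (rLMwc E = Set.univ ↔ IsLMwc (ContinuousLinearMap.id ℝ E)) ∧
    (IsDedekindComplete E →
      ∃ L : Lattice (RegOp E), IsRegOpBanachLattice L ∧
        IsClosedOrderIdeal (rLLwc E) ∧ IsClosedOrderIdeal (rLMwc E)) := by
  have hLcomp (S : E →L[ℝ] E) (hS : S ∈ lLwc E E) (T : E →L[ℝ] E) : S.comp T ∈ lLwc E E :=
    IsLLwc.comp hS T
  have hMcomp (S T : E →L[ℝ] E) (hT : T ∈ lMwc E E) : S.comp T ∈ lMwc E E :=
    IsLMwc.comp_left hT S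
  refine ⟨⟨(RegOp.regularPart (lLwc E E)).toNonUnitalSubalgebra ?_, rfl⟩,
    ⟨(RegOp.regularPart (lMwc E E)).toNonUnitalSubalgebra ?_, rfl⟩, ?_, ?_, fun hE =>
    ⟨RegOp.latticeOfIsDedekindComplete hE, RegOp.isRegOpBanachLattice hE, ?_, ?_⟩⟩
  · exact RegOp.mul_mem_regularPart fun S hS T _ => hLcomp S hS T
  · exact RegOp.mul_mem_regularPart fun S _ T hT => hMcomp S T hT
  · exact RegOp.regularPart_eq_univ_iff fun h => eq_top_iff.mpr fun T _ => hLcomp _ h T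
  · exact RegOp.regularPart_eq_univ_iff fun h => eq_top_iff.mpr fun T _ => hMcomp T _ h
  · exact RegOp.isClosedOrderIdeal_regularPart hE hasDominationProperty_lLwc isClosed_lLwc
  · exact RegOp.isClosedOrderIdeal_regularPart hE hasDominationProperty_lMwc isClosed_lMwc
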